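/- Let $k$ be an algebraically closed field of characteristic $0$ and let $(R,\mathfrak m_R,k)$ be a one-dimensional complete (Noetherian) local $k$-algebra which is a domain, with residue field $k$ and embedding dimension $n$. Let $Q$ be its field of fractions, $\overline R$ its integral closure in $Q$ (a discrete valuation ring with residue field $k$, with valuation $\operatorname{ord}$), and $\mathfrak C_R=R:_Q\overline R$ its conductor. Let $x_1,\dots,x_n$ be minimal generators of $\mathfrak m_R$ and $t$ a uniformizing parameter of $\overline R$ such that $x_i=\alpha_i t^{a_i}$ with units $\alpha_i\in\overline R$, $\alpha_1=1$ and $a_1\le\dots\le a_n$; let $\Phi:k[[X_1,\dots,X_n]]\to R$ be the surjection of $k$-algebras with $X_i\mapsto x_i$. Assume $\mathfrak C_R\subseteq\mathfrak m_R^2$. Let $c$ be the least valuation of an element of $\mathfrak C_R$, and let $b_1<\dots<b_s$ be the integers $v$ with $c-a_1\le v\le c-1$ that are not of the form $\operatorname{ord}(r)$, $r\in R$. Let $S=R[\mathfrak C_R/x_1]\subseteq Q$ and $T_j=t^{b_j}\in S$; then $S=R[T_1,\dots,T_s]$. Let $\Psi:k[[X_1,\dots,X_n,T_1,\dots,T_s]]\to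 S$ be the surjection of $k$-algebras with $X_i\mapsto x_i$, $T_j\mapsto T_j$. For an analytic $k$-algebra $A=k[[Y_1,\dots,Y_m]]/I$, with $y_i$ the image of $Y_i$, the universally finite module of differentials $\Omega_A$ is the cokernel of the Jacobian matrix of $I$, that is, the $A$-module generated by $dy_1,\dots,dy_m$ with relations $\sum_i\frac{\partial f}{\partial Y_i}(y)\,dy_i=0$ for $f\in I$; $\tau(\Omega_A)$ is its torsion submodule. Form $\Omega_R$ and $\Omega_S$ with the presentations $\Phi$ and $\Psi$. Suppose that $\tau_1,\dots,\tau_N\in\tau(\Omega_S)$, with $N=ns+\binom s2+1$, are linearly independent over $k$, and that each of them can be written as $\sum_{i=1}^n r_i\,dx_i+\sum_{j=1}^s r_j'\,dT_j$ with $r_i,r_j'\in S$ and no $r_j'$ a unit of $S$. Then there is a (canonical) $R$-linear map $F:\Omega_R\to\Omega_S$ with $F(dx_i)=dx_i$ for all $i$, and there are $q_1,\dots,q_N\in k$, not all zero, and a nonzero torsion element $\omega\in\tau(\Omega_R)$ with $F(\omega)=\sum_{l=1}^N q_l\tau_l$. In particular, $\tau(\Omega_R)\neq0$. -/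

import Mathlib

noncomputable section

/-- The Jacobian relations of an analytic `k`-algebra `A` presented by `Φ : k⟦X_σ⟧ → A`
(which is meant to be surjective): the `A`-submodule of `A^σ` generated by the columns
`(∂f/∂X_i)_i`, entries read in `A`, for `f` in the defining ideal `ker Φ`. -/
def jacobianRelations {k : Type*} [Field k] {σ : Type*} {A : Type*} [CommRing A] [Algebra k A]
    (Φ : MvPowerSeries σ k →ₐ[k] A) : Submodule A (σ → A) :=
  Submodule.span A
    {v | ∃ f : MvPowerSeries σ k, Φ f = 0 ∧ v = fun i => Φ (MvPowerSeries.pderiv k i f)}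

/-- The universally finite module of differentials of the analytic `k`-algebra `A` presented by
`Φ : k⟦X_σ⟧ ↠ A`: the cokernel of the Jacobian matrix of the defining ideal. The class of a
column `r : σ → A` is `∑ i, r i • d(Φ X_i)`. -/
abbrev UnivFinDiff {k : Type*} [Field k] {σ : Type*} {A : Type*} [CommRing A] [Algebra k A]
    (Φ : MvPowerSeries σ k →ₐ[k] A) : Type _ :=
  (σ → A) ⧸ jacobianRelations Φ

/-- The element `∑ i, r i • d(Φ X_i)` of the universally finite module of differentials. -/
def UnivFinDiff.ofCoeffs {k : Type*} [Field k] {σ : Type*} {A : Type*} [CommRing A] [Algebra k A]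
    (Φ : MvPowerSeries σ k →ₐ[k] A) (r : σ → A) : UnivFinDiff Φ :=
  (jacobianRelations Φ).mkQ r

/-- The differential `d(Φ X_i)` of the `i`-th coordinate. -/
def UnivFinDiff.dX {k : Type*} [Field k] {σ : Type*} [DecidableEq σ] {A : Type*} [CommRing A]
    [Algebra k A] (Φ : MvPowerSeries σ k →ₐ[k] A) (i : σ) : UnivFinDiff Φ :=
  UnivFinDiff.ofCoeffs Φ (Pi.single i 1)

/-- The integral closure of the domain `R` in its field of fractions. -/
abbrev normalization (R : Type*) [CommRing R] [IsDomain R] : Subalgebra R (FractionRing R) :=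
  integralClosure R (FractionRing R)

/-- The conductor `R :_Q R̄`, as an `R`-submodule of `Q = Frac R`. -/
def fracConductor (R : Type*) [CommRing R] [IsDomain R] : Submodule R (FractionRing R) :=
  (1 : Submodule R (FractionRing R)) / Subalgebra.toSubmodule (normalization R)

/-- The conductor as an ideal of `R` (no element is lost, since `1 ∈ R̄` forces
`R :_Q R̄ ⊆ R`). -/
def conductorIdeal (R : Type*) [CommRing R] [IsDomain R] : Ideal R :=
  (fracConductor R).comap (Algebra.linearMap R (FractionRing R))

/-- The ring `R[C_R / x]`, as a subring of `Frac R`. -/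
def conductorTransform (R : Type*) [CommRing R] [IsDomain R] (x : R) :
    Subalgebra R (FractionRing R) :=
  Algebra.adjoin R {y | ∃ c ∈ fracConductor R, y = c / algebraMap R (FractionRing R) x}

/-- `t` is a uniformizing parameter of the domain `A`: `t ≠ 0` and `(t)` is the set of non-units,
that is, `A` is local with maximal ideal `(t)`. -/
def IsUniformizingParameter {A : Type*} [CommRing A] (t : A) : Prop :=
  t ≠ 0 ∧ ∀ y : A, t ∣ y ↔ ¬ IsUnit y

/-- `ord y = v` with respect to the uniformizing parameter `t`: `y = u t^v` with `u` a unit. -/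
def HasOrd {A : Type*} [CommRing A] (t y : A) (v : ℕ) : Prop :=
  ∃ u : Aˣ, y = u * t ^ v

/-- The valuation semigroup of `R` with respect to a uniformizing parameter `t` of `R̄`. -/
def valuationSemigroup (R : Type*) [CommRing R] [IsDomain R] (t : normalization R) : Set ℕ :=
  {v | ∃ r : R, HasOrd t (algebraMap R (normalization R) r) v}

/-- `c = c_R` is the least valuation of an element of the conductor. -/
def IsConductorExponent (R : Type*) [CommRing R] [IsDomain R] (t : normalization R) (c : ℕ) :
    Prop :=
  IsLeast {v | ∃ r ∈ conductorIdeal R, HasOrd t (algebraMap R (normalization R) r) v} c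

end

/-! ### Power series: homomorphisms, derivations and renaming of variables -/

noncomputable section

/-! The conductor is `t ^ c R̄`, and `C_R ⊆ m²` forces `c ≥ 2 a₁`. Since `b_j ≥ c - a₁`, all
products `x_i T_j` and `T_i T_j` have order at least `c`, so they lie in `R`, and `S = R + ∑ k T_j`.

Hence `d(x_i T_j)` and `d(T_i T_j)` come from `Ω_R`. Modulo the image of `F`, they trade `x_i dT_j`
for `-T_j dx_i` and `T_j dT_i` for `-T_i dT_j`, and kill `T_i dT_i` in characteristic 0. So
differentials with nonunit `dT_j`-coefficients span at most `ns + s.choose 2` dimensions modulo that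
image (`ofCoeffs_mem_range_sup_span`). With one more `τ_l` than that, a nontrivial combination
equals `F ω`; it is nonzero by independence.

That `ω` is torsion follows because `F` has torsion kernel (`mem_torsion_of_inlCoeffs_mem`): the
derivation `R → Q ⊗ Ω_R` extends to `Q`, restricts to `S`, and respects the Jacobian relations of
`Ψ` by a chain rule for power series. Homomorphisms and derivations are not assumed continuous;
Krull's intersection theorem replaces continuity. -/

open MvPowerSeries in
theorem MvPowerSeries.exists_eq_C_add_sum_X_mul {k σ : Type*} [CommRing k] [Fintype σ]
    (f : MvPowerSeries σ k) :
    ∃ h : σ → MvPowerSeries σ k, f = C (constantCoeff f) + ∑ i, X i * h i := by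
  classical
  rcases isEmpty_or_nonempty σ with hσ | hσ
  · refine ⟨fun i => isEmptyElim i, ?_⟩
    ext d
    simp [Subsingleton.elim d 0]
  have hch : ∀ d : σ →₀ ℕ, d ≠ 0 → ∃ i, d i ≠ 0 := fun d hd => Finsupp.ne_iff.mp hd
  -- Each nonconstant monomial is charged to one variable `idx d` dividing it; `h i` collects the
  -- quotients of those charged to `i`.
  choose! idx hidx using hch
  obtain ⟨h, hh⟩ : ∃ h : σ → MvPowerSeries σ k, ∀ i e, coeff e (h i) =
      if idx (e + Finsupp.single i 1) = i then coeff (e + Finsupp.single i 1) f else 0 :=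
    ⟨fun i e => _, fun _ _ => rfl⟩
  refine ⟨h, ?_⟩
  ext d
  by_cases hd : d = 0
  · subst hd
    simp [coeff_zero_eq_constantCoeff_apply]
  · have hle : Finsupp.single (idx d) 1 ≤ d := by
      simpa [Finsupp.single_le_iff] using Nat.one_le_iff_ne_zero.mpr (hidx d hd)
    rw [map_add, coeff_C, if_neg hd, zero_add, map_sum, Finset.sum_eq_single (idx d)]
    · rw [X, coeff_monomial_mul, if_pos hle, one_mul, hh, tsub_add_cancel_of_le hle, if_pos rfl]
    · intro i _ hi
      rw [X, coeff_monomial_mul]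
      split_ifs with hle
      · rw [one_mul, hh, tsub_add_cancel_of_le hle, if_neg (Ne.symm hi)]
      · rfl
    · simp

/-- Algebra homomorphisms from a power series ring into a Noetherian domain are determined by the
images of the variables, if these generate a proper ideal. -/
theorem MvPowerSeries.algHom_ext_of_span_ne_top {k σ S : Type*} [CommRing k] [Finite σ]
    [CommRing S] [IsDomain S] [IsNoetherianRing S] [Algebra k S]
    (φ ψ : MvPowerSeries σ k →ₐ[k] S) (h : ∀ i, φ (X i) = ψ (X i)) (J : Ideal S) (hJ : J ≠ ⊤)
    (hJX : ∀ i, ψ (X i) ∈ J) : φ = ψ := by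
  cases nonempty_fintype σ
  -- Splitting off the variables gains one power of `J` per step; the powers of `J` meet in zero by
  -- Krull.
  have key : ∀ (N : ℕ) (f : MvPowerSeries σ k), φ f - ψ f ∈ J ^ N := by
    intro N
    induction N with
    | zero => simp
    | succ N ih =>
      intro f
      obtain ⟨g, hg⟩ := f.exists_eq_C_add_sum_X_mul
      have hC (ρ : MvPowerSeries σ k →ₐ[k] S) (a : k) : ρ (C a) = algebraMap k S a :=
        ρ.commutes a
      rw [hg]
      simp only [map_add, map_sum, map_mul, hC, h, add_sub_add_left_eq_sub,
        ← Finset.sum_sub_distrib, ← mul_sub]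
      rw [pow_succ']
      exact sum_mem fun i _ => Ideal.mul_mem_mul (hJX i) (ih _)
  ext f
  have := Ideal.iInf_pow_eq_bot_of_isDomain J hJ
  rw [← sub_eq_zero, ← Ideal.mem_bot, ← this]
  exact Ideal.mem_iInf.mpr fun N => key N f

/-- The chain rule for derivations of a Noetherian domain with values in a finitely generated
torsion-free module. -/
theorem Derivation.apply_algHom_mvPowerSeries {k σ S M : Type*} [CommRing k] [Fintype σ]
    [CommRing S] [IsDomain S] [IsNoetherianRing S] [Algebra k S] [AddCommGroup M] [Module k M]
    [Module S M] [Module.IsTorsionFree S M] (d : Derivation k S M)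
    (ψ : MvPowerSeries σ k →ₐ[k] S) (J : Ideal S) (hJ : J ≠ ⊤)
    (hJX : ∀ i, ψ (MvPowerSeries.X i) ∈ J) (L : Submodule S M) (hL : L.FG) (hd : ∀ y, d y ∈ L)
    (f : MvPowerSeries σ k) :
    d (ψ f) = ∑ i, ψ (MvPowerSeries.pderiv k i f) • d (ψ (MvPowerSeries.X i)) := by
  classical
  have := Module.Finite.iff_fg.mpr hL
  -- The defect `E` is a derivation along `ψ` that kills constants and variables, so `E f = ∑ ψ(X_i)
  -- E(g_i)`. Iterating puts it in every `J ^ N L`; Krull applies to the finitely generated `L`,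
  -- whereas `M` itself may be too large.
  set E : MvPowerSeries σ k → M := fun f =>
    d (ψ f) - ∑ i, ψ (MvPowerSeries.pderiv k i f) • d (ψ (MvPowerSeries.X i)) with hE
  have hadd : ∀ f g, E (f + g) = E f + E g := fun f g => by
    simp only [hE, map_add, add_smul, Finset.sum_add_distrib]; abel
  have hmul : ∀ f g, E (f * g) = ψ f • E g + ψ g • E f := fun f g => by
    simp only [hE, map_mul, Derivation.leibniz, smul_eq_mul, map_add, add_smul, smul_sub,
      Finset.smul_sum, smul_smul, Finset.sum_add_distrib]
    abel
  have hzero : E 0 = 0 := by simp [hE]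
  have hX : ∀ i, E (MvPowerSeries.X i) = 0 := fun i => by
    simp only [hE]
    rw [Finset.sum_eq_single i (fun j _ hj => by
      rw [MvPowerSeries.pderiv_X_of_ne (Ne.symm hj)]; simp) (by simp)]
    simp
  have hC : ∀ a, E (MvPowerSeries.C a) = 0 := fun a => by
    have : ψ (MvPowerSeries.C a) = algebraMap k S a := ψ.commutes a
    simp [hE, this]
  have hsum : ∀ g : σ → MvPowerSeries σ k, E (∑ i, g i) = ∑ i, E (g i) := fun g =>
    map_sum (⟨⟨E, hzero⟩, hadd⟩ : MvPowerSeries σ k →+ M) _ _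
  have hEL : ∀ f, E f ∈ L := fun f =>
    sub_mem (hd _) (sum_mem fun i _ => L.smul_mem _ (hd _))
  have key : ∀ (N : ℕ) (f : MvPowerSeries σ k),
      (⟨E f, hEL f⟩ : L) ∈ (J ^ N • ⊤ : Submodule S L) := by
    intro N
    induction N with
    | zero => simp
    | succ N ih =>
      intro f
      obtain ⟨g, hg⟩ := f.exists_eq_C_add_sum_X_mul
      have : (⟨E f, hEL f⟩ : L) = ∑ i, ψ (MvPowerSeries.X i) • (⟨E (g i), hEL _⟩ : L) := by
        ext
        rw [AddSubmonoidClass.coe_finsetSum]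
        simp only [SetLike.val_smul]
        conv_lhs => rw [hg]
        simp [hadd, hC, hsum, hmul, hX]
      rw [this, pow_succ', mul_smul]
      exact sum_mem fun i _ => Submodule.smul_mem_smul (hJX i) (ih _)
  have hbot := Ideal.iInf_pow_smul_eq_bot_of_isTorsionFree (M := L) J hJ
  have : (⟨E f, hEL f⟩ : L) ∈ (⊥ : Submodule S L) := by
    rw [← hbot]
    exact Submodule.mem_iInf _ |>.mpr fun N => key N f
  exact sub_eq_zero.mp (congrArg Subtype.val ((Submodule.mem_bot S).mp this))

theorem MvPowerSeries.pderiv_rename_apply {k σ τ : Type*} [CommRing k]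
    (e : σ ↪ τ) (i : σ) (f : MvPowerSeries σ k) :
    pderiv k (e i) (rename e f) = rename e (pderiv k i f) := by
  classical
  ext x
  rw [coeff_pderiv]
  have hadd (y : σ →₀ ℕ) : Finsupp.embDomain e y + Finsupp.single (e i) 1
      = Finsupp.embDomain e (y + Finsupp.single i 1) := by
    rw [← Finsupp.embDomain_single]
    simp [Finsupp.embDomain_eq_mapDomain, Finsupp.mapDomain_add]
  by_cases hx : x ∈ Set.range (Finsupp.embDomain e)
  · obtain ⟨y, rfl⟩ := hx
    rw [hadd, coeff_embDomain_rename, coeff_embDomain_rename, coeff_pderiv]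
    simp
  · have hx' : x + Finsupp.single (e i) 1 ∉ Set.range (Finsupp.embDomain e) := by
      rintro ⟨y, hy⟩
      refine hx ⟨y - Finsupp.single i 1, add_right_cancel (b := Finsupp.single (e i) 1) ?_⟩
      rw [hadd, tsub_add_cancel_of_le, hy]
      have := DFunLike.congr_fun hy (e i)
      simp at this
      simp [this]
    rw [coeff_rename_eq_zero, coeff_rename_eq_zero, zero_mul]
    · simpa [Finsupp.embDomain_eq_mapDomain] using hx
    · simpa [Finsupp.embDomain_eq_mapDomain] using hx'

theorem MvPowerSeries.pderiv_rename_of_notMem_range {k σ τ : Type*} [CommRing k]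
    (e : σ ↪ τ) {j : τ} (hj : j ∉ Set.range e) (f : MvPowerSeries σ k) :
    pderiv k j (rename e f) = 0 := by
  classical
  ext x
  rw [coeff_pderiv, coeff_rename_eq_zero, zero_mul, map_zero]
  rintro ⟨y, hy⟩
  have := DFunLike.congr_fun hy j
  simp [← Finsupp.embDomain_eq_mapDomain, Finsupp.embDomain_of_notMem_range _ _ _ hj] at this

/-- A derivation into a vector space over the fraction field extends to the fraction field. -/
theorem Derivation.exists_extend_fractionRing {k R Q M : Type*} [CommRing k] [CommRing R]
    [IsDomain R] [Field Q] [Algebra R Q] [IsFractionRing R Q] [Algebra k R] [Algebra k Q]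
    [IsScalarTower k R Q] [AddCommGroup M] [Module k M] [Module R M] [Module Q M]
    [IsScalarTower R Q M] [IsScalarTower k R M] [IsScalarTower k Q M] (d : Derivation k R M) :
    ∃ d' : Derivation k Q M, ∀ r, d' (algebraMap R Q r) = d r := by
  have hunit : ∀ x : nonZeroDivisors R, IsUnit (algebraMap R (Module.End R M) x) := by
    intro x
    have hx : algebraMap R Q x ≠ 0 :=
      IsFractionRing.to_map_ne_zero_of_mem_nonZeroDivisors x.2
    rw [Module.End.isUnit_iff]
    constructor
    · intro m m' h
      rw [Module.algebraMap_end_apply, Module.algebraMap_end_apply, ← algebraMap_smul Q,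
        ← algebraMap_smul Q (x : R) m'] at h
      exact smul_right_injective M hx h
    · intro m
      refine ⟨(algebraMap R Q x)⁻¹ • m, ?_⟩
      rw [Module.algebraMap_end_apply, ← algebraMap_smul Q, smul_inv_smul₀ hx]
  -- The Kähler differentials of `Q` localize those of `R`, and nonzero elements of `R` act
  -- invertibly on `M`.
  let g := IsLocalizedModule.lift (nonZeroDivisors R) (KaehlerDifferential.map k k R Q)
    d.liftKaehlerDifferential hunit
  let g' := LinearMap.extendScalarsOfIsLocalization (nonZeroDivisors R) Q g
  refine ⟨g'.compDer (KaehlerDifferential.D k Q), fun r => ?_⟩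
  have := IsLocalizedModule.lift_apply (nonZeroDivisors R) (KaehlerDifferential.map k k R Q)
    d.liftKaehlerDifferential hunit (KaehlerDifferential.D k R r)
  rw [KaehlerDifferential.map_D, Derivation.liftKaehlerDifferential_comp_D] at this
  exact this

end

/-! ### Total differentials, the canonical map and a dimension count -/

noncomputable section

namespace UnivFinDiff

section Total

variable {k : Type*} [Field k] {σ : Type*} {A : Type*} [CommRing A] [Algebra k A]
  (Φ : MvPowerSeries σ k →ₐ[k] A)

/-- The total differential `∑ i, (∂f/∂X_i) dX_i` of a power series. -/
def total (f : MvPowerSeries σ k) : UnivFinDiff Φ :=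
  ofCoeffs Φ fun i => Φ (MvPowerSeries.pderiv k i f)

theorem total_sub (f g : MvPowerSeries σ k) : total Φ (f - g) = total Φ f - total Φ g := by
  rw [total, total, total, ofCoeffs, ofCoeffs, ofCoeffs, ← map_sub]
  congr 1
  ext i
  simp

/-- The Jacobian column of `f - g` is a defining relation, so `total` descends to a differential on
`A`. -/
theorem total_eq_of_apply_eq {f g : MvPowerSeries σ k} (h : Φ f = Φ g) :
    total Φ f = total Φ g := by
  rw [← sub_eq_zero, ← total_sub, total, ofCoeffs, Submodule.mkQ_apply,
    Submodule.Quotient.mk_eq_zero]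
  exact Submodule.subset_span ⟨f - g, by rw [map_sub, h, sub_self], rfl⟩

theorem total_X_mul_X [DecidableEq σ] (i j : σ) :
    total Φ (MvPowerSeries.X i * MvPowerSeries.X j) =
      Φ (MvPowerSeries.X i) • dX Φ j + Φ (MvPowerSeries.X j) • dX Φ i := by
  simp only [total, dX, ofCoeffs, ← map_smul, ← map_add]
  congr 1
  ext l
  have h (i : σ) : Φ (MvPowerSeries.pderiv k l (MvPowerSeries.X i)) =
      (Pi.single i 1 : σ → A) l := by
    rcases eq_or_ne i l with rfl | h
    · simp
    · simp [h.symm, MvPowerSeries.pderiv_X_of_ne h]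
  simp [Derivation.leibniz, h]

theorem ofCoeffs_eq_sum [Fintype σ] [DecidableEq σ] (r : σ → A) :
    ofCoeffs Φ r = ∑ i, r i • dX Φ i := by
  simp only [dX, ofCoeffs, ← map_smul, ← map_sum]
  congr 1
  ext j
  simp [Pi.single_apply]

end Total

section Map

variable {k : Type*} [Field k] {σ τ : Type*} {R S : Type*} [CommRing R] [Algebra k R]
  [CommRing S] [Algebra k S] [Algebra R S]
  (Φ : MvPowerSeries σ k →ₐ[k] R) (Ψ : MvPowerSeries (σ ⊕ τ) k →ₐ[k] S)

variable (σ τ R S) in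
/-- Extension of a column of coefficients by zero. -/
def inlCoeffs : (σ → R) →ₗ[R] (σ ⊕ τ → S) where
  toFun v := Sum.elim (fun i => algebraMap R S (v i)) 0
  map_add' v w := by ext (i | i) <;> simp
  map_smul' r v := by ext (i | i) <;> simp [Algebra.smul_def]

theorem inlCoeffs_pderiv
    (h : ∀ f, Ψ (MvPowerSeries.rename (Function.Embedding.inl : σ ↪ σ ⊕ τ) f) =
      algebraMap R S (Φ f)) (f : MvPowerSeries σ k) :
    inlCoeffs σ τ R S (fun i => Φ (MvPowerSeries.pderiv k i f)) = fun i =>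
      Ψ (MvPowerSeries.pderiv k i
        (MvPowerSeries.rename (Function.Embedding.inl : σ ↪ σ ⊕ τ) f)) := by
  ext (i | j)
  · have := MvPowerSeries.pderiv_rename_apply (Function.Embedding.inl : σ ↪ σ ⊕ τ) i f
    simp only [Function.Embedding.inl_apply] at this
    rw [this, h]
    rfl
  · rw [MvPowerSeries.pderiv_rename_of_notMem_range _ (by simp)]
    simp [inlCoeffs]

variable
  (h : ∀ f, Ψ (MvPowerSeries.rename (Function.Embedding.inl : σ ↪ σ ⊕ τ) f) =
    algebraMap R S (Φ f))

/-- The canonical map `Ω_R → Ω_S` for a presentation of `S` extending one of `R`. -/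
def map : UnivFinDiff Φ →ₗ[R] UnivFinDiff Ψ :=
  (jacobianRelations Φ).liftQ
    (((jacobianRelations Ψ).mkQ.restrictScalars R).comp (inlCoeffs σ τ R S)) (by
      refine Submodule.span_le.mpr ?_
      rintro _ ⟨f, hf, rfl⟩
      rw [SetLike.mem_coe, LinearMap.mem_ker, LinearMap.comp_apply, inlCoeffs_pderiv Φ Ψ h]
      exact (Submodule.Quotient.mk_eq_zero _).mpr
        (Submodule.subset_span ⟨_, by rw [h, hf, map_zero], rfl⟩))

theorem map_ofCoeffs (v : σ → R) :
    map Φ Ψ h (ofCoeffs Φ v) = ofCoeffs Ψ (inlCoeffs σ τ R S v) := rfl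

theorem map_dX [DecidableEq σ] [DecidableEq τ] (i : σ) :
    map Φ Ψ h (dX Φ i) = dX Ψ (Sum.inl i) := by
  rw [dX, map_ofCoeffs, dX]
  congr 1
  ext (j | j)
  · rcases eq_or_ne j i with rfl | hj <;> simp [inlCoeffs, *]
  · simp [inlCoeffs]

theorem map_total (f : MvPowerSeries σ k) : map Φ Ψ h (total Φ f) =
    total Ψ (MvPowerSeries.rename (Function.Embedding.inl : σ ↪ σ ⊕ τ) f) := by
  rw [total, map_ofCoeffs, inlCoeffs_pderiv Φ Ψ h, total]

/-- A value in `R` is also the value of a series in the `X_i` alone, and `total` depends only on the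
value. This puts `d(x_i T_j)` and `d(T_i T_j)` in the image of `Ω_R`. -/
theorem total_mem_range_map (hΦ : Function.Surjective Φ) (g : MvPowerSeries (σ ⊕ τ) k) (r : R)
    (hg : Ψ g = algebraMap R S r) : total Ψ g ∈ LinearMap.range (map Φ Ψ h) := by
  obtain ⟨f, rfl⟩ := hΦ r
  exact ⟨total Φ f, by rw [map_total, total_eq_of_apply_eq Ψ ((h f).trans hg.symm)]⟩

end Map

end UnivFinDiff

/-- Modulo `I` the `τ l` lie in a space of dimension at most `card κ`. -/
theorem exists_ne_zero_sum_mem_of_card_lt {k V ι κ : Type*} [Field k] [AddCommGroup V] [Module k V]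
    [Fintype ι] [Fintype κ] (I : Submodule k V) (w : κ → V) (τ : ι → V)
    (hτ : ∀ l, τ l ∈ I ⊔ Submodule.span k (Set.range w))
    (hcard : Fintype.card κ < Fintype.card ι) : ∃ q : ι → k, q ≠ 0 ∧ ∑ l, q l • τ l ∈ I := by
  classical
  have hmem : ∀ l, I.mkQ (τ l) ∈ Submodule.span k (Set.range (I.mkQ ∘ w)) := by
    intro l
    obtain ⟨y, hy, z, hz, hyz⟩ := Submodule.mem_sup.mp (hτ l)
    rw [← hyz, map_add, (Submodule.Quotient.mk_eq_zero I).mpr hy |> fun e => (e : I.mkQ y = 0),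
      zero_add, Set.range_comp, Submodule.span_image]
    exact Submodule.mem_map_of_mem hz
  have hdep : ¬ LinearIndependent k (fun l => (⟨I.mkQ (τ l), hmem l⟩ :
      Submodule.span k (Set.range (I.mkQ ∘ w)))) := by
    intro hli
    have := FiniteDimensional.span_of_finite k (Set.finite_range (I.mkQ ∘ w))
    exact absurd (hli.fintype_card_le_finrank.trans (finrank_range_le_card _)) (not_le.mpr hcard)
  rw [Fintype.not_linearIndependent_iff] at hdep
  obtain ⟨q, hq, l, hl⟩ := hdep
  refine ⟨q, fun h => hl (by rw [h]; rfl), ?_⟩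
  rw [← Submodule.Quotient.mk_eq_zero, ← Submodule.mkQ_apply, map_sum]
  have := congrArg Subtype.val hq
  simpa using this

end

/-! ### Torsion of the kernel of `Ω_R → Ω_S` -/

noncomputable section

section Torsion

variable {k : Type*} [Field k] {R : Type*} [CommRing R] [Algebra k R]
  {Q : Type*} [Field Q] [Algebra R Q]
  {σ : Type*} (Φ : MvPowerSeries σ k →ₐ[k] R)

variable (Q) in
/-- The Jacobian relations over the fraction field. -/
def fracJacobianRelations : Submodule Q (σ → Q) :=
  Submodule.span Q ((fun v i => algebraMap R Q (v i)) '' (jacobianRelations Φ : Set (σ → R)))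

theorem ofCoeffs_mem_torsion_of_mem_fracJacobianRelations [IsDomain R] [IsFractionRing R Q]
    (v : σ → R)
    (hv : (fun i => algebraMap R Q (v i)) ∈ fracJacobianRelations Q Φ) :
    UnivFinDiff.ofCoeffs Φ v ∈ Submodule.torsion R (UnivFinDiff Φ) := by
  -- Clearing denominators: a relation over `Q` has a nonzero `R`-multiple that is a relation over
  -- `R`.
  have key : ∀ w ∈ fracJacobianRelations Q Φ, ∃ r : R, r ≠ 0 ∧ ∃ u ∈ jacobianRelations Φ,
      (algebraMap R Q r) • w = fun i => algebraMap R Q (u i) := by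
    intro w hw
    induction hw using Submodule.span_induction with
    | mem w hw =>
      obtain ⟨u, hu, rfl⟩ := hw
      exact ⟨1, one_ne_zero, u, hu, by simp⟩
    | zero => exact ⟨1, one_ne_zero, 0, zero_mem _, by ext; simp⟩
    | add w w' _ _ hw hw' =>
      obtain ⟨r, hr, u, hu, h⟩ := hw
      obtain ⟨r', hr', u', hu', h'⟩ := hw'
      refine ⟨r * r', mul_ne_zero hr hr', r' • u + r • u',
        add_mem (Submodule.smul_mem _ _ hu) (Submodule.smul_mem _ _ hu'), ?_⟩
      rw [smul_add, map_mul]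
      nth_rw 1 [mul_comm]
      rw [mul_smul, mul_smul, h, h']
      ext i
      simp [Algebra.smul_def]
    | smul q w _ hw =>
      obtain ⟨r, hr, u, hu, h⟩ := hw
      obtain ⟨a, b, hb, rfl⟩ := IsFractionRing.div_surjective (A := R) q
      have hb0 : b ≠ 0 := nonZeroDivisors.ne_zero hb
      have hbQ : algebraMap R Q b ≠ 0 := by simpa using hb0
      refine ⟨r * b, mul_ne_zero hr hb0, a • u, Submodule.smul_mem _ _ hu, ?_⟩
      have : (fun i => algebraMap R Q ((a • u) i)) = algebraMap R Q a • fun i =>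
        algebraMap R Q (u i) := by ext i; simp
      rw [this, ← h, smul_smul, smul_smul, map_mul]
      congr 1
      field_simp
  obtain ⟨r, hr, u, hu, h⟩ := key _ hv
  rw [Submodule.mem_torsion_iff]
  refine ⟨⟨r, mem_nonZeroDivisors_of_ne_zero hr⟩, ?_⟩
  have hru : r • v = u := by
    ext i
    apply IsFractionRing.injective R Q
    simpa using congrFun h i
  change r • UnivFinDiff.ofCoeffs Φ v = 0
  rw [UnivFinDiff.ofCoeffs, ← map_smul, hru]
  exact (Submodule.Quotient.mk_eq_zero _).mpr hu

/-- The derivation `R → Q ⊗ Ω_R`. -/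
theorem exists_derivation_quotient_fracJacobianRelations [Algebra k Q]
    [IsScalarTower k R Q] (hΦ : Function.Surjective Φ) :
    ∃ d : Derivation k R ((σ → Q) ⧸ fracJacobianRelations Q Φ), ∀ f,
      d (Φ f) = (fracJacobianRelations Q Φ).mkQ
        fun i => algebraMap R Q (Φ (MvPowerSeries.pderiv k i f)) := by
  let D : MvPowerSeries σ k →ₗ[k] ((σ → Q) ⧸ fracJacobianRelations Q Φ) :=
    { toFun := fun f => (fracJacobianRelations Q Φ).mkQ
        fun i => algebraMap R Q (Φ (MvPowerSeries.pderiv k i f))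
      map_add' := fun f g => by rw [← map_add]; congr 1; ext i; simp
      map_smul' := fun a f => by
        rw [RingHom.id_apply, ← LinearMap.map_smul_of_tower]
        congr 1; ext i
        simp [Algebra.smul_def, ← IsScalarTower.algebraMap_apply] }
  have hD : ∀ f g, Φ f = Φ g → D f = D g := by
    intro f g h
    rw [← sub_eq_zero, ← map_sub]
    refine (Submodule.Quotient.mk_eq_zero _).mpr (Submodule.subset_span ⟨_, Submodule.subset_span
      ⟨f - g, by rw [map_sub, h, sub_self], rfl⟩, rfl⟩)
  have hinv := Function.surjInv_eq hΦ
  have hmul : ∀ f g, D (f * g) = Φ f • D g + Φ g • D f := by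
    intro f g
    rw [← algebraMap_smul Q (Φ f), ← algebraMap_smul Q (Φ g) (D f)]
    change (fracJacobianRelations Q Φ).mkQ _ = _ • (fracJacobianRelations Q Φ).mkQ _ +
      _ • (fracJacobianRelations Q Φ).mkQ _
    rw [← map_smul, ← map_smul, ← map_add]
    congr 1; ext i
    simp [Algebra.smul_def]
  let d : R →ₗ[k] ((σ → Q) ⧸ fracJacobianRelations Q Φ) :=
    { toFun := fun r => D (Function.surjInv hΦ r)
      map_add' := fun r r' => by rw [← map_add]; exact hD _ _ (by simp [hinv])
      map_smul' := fun a r => by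
        rw [RingHom.id_apply, ← map_smul]; exact hD _ _ (by simp [hinv]) }
  refine ⟨Derivation.mk' d fun r r' => ?_, fun f => hD _ _ (hinv _)⟩
  change D _ = r • D _ + r' • D _
  nth_rw 2 [← hinv r]
  nth_rw 3 [← hinv r']
  rw [← hmul]
  exact hD _ _ (by simp [hinv])

end Torsion

section Extension

variable {k : Type*} [Field k] {R : Type*} [CommRing R] [Algebra k R]
  {Q : Type*} [Field Q] [Algebra R Q] [Algebra k Q]
  [IsScalarTower k R Q] {S : Subalgebra R Q}
  {σ τ : Type*} (Φ : MvPowerSeries σ k →ₐ[k] R)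
  (Ψ : MvPowerSeries (σ ⊕ τ) k →ₐ[k] S)

/-- Serves to make `S` Noetherian, as Krull's theorem requires. -/
theorem finite_of_exists_eq_add_sum [Fintype τ]
    (hS : ∀ y : S, ∃ (r : R) (q : τ → k), y = algebraMap R S r +
      ∑ j, q j • Ψ (MvPowerSeries.X (Sum.inr j))) : Module.Finite R S := by
  have h1 : (⊤ : Submodule R S) = Submodule.span R
      (insert 1 (Set.range fun j => Ψ (MvPowerSeries.X (Sum.inr j)))) := by
    refine (eq_top_iff.mpr fun y _ => ?_).symm
    obtain ⟨r, q, rfl⟩ := hS y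
    refine add_mem ?_ (sum_mem fun j _ => ?_)
    · rw [Algebra.algebraMap_eq_smul_one]
      exact Submodule.smul_mem _ _ (Submodule.subset_span (Set.mem_insert _ _))
    · rw [← algebraMap_smul R (q j)]
      exact Submodule.smul_mem _ _ (Submodule.subset_span (Set.mem_insert_of_mem _ ⟨j, rfl⟩))
  exact ⟨h1 ▸ Submodule.fg_span ((Set.finite_range _).insert _)⟩

theorem apply_rename_inl [Finite σ] [IsNoetherianRing S]
    (hX : ∀ i, Ψ (MvPowerSeries.X (Sum.inl i)) = algebraMap R S (Φ (MvPowerSeries.X i)))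
    (J : Ideal S) (hJ : J ≠ ⊤) (hJX : ∀ i, Ψ (MvPowerSeries.X i) ∈ J) (f : MvPowerSeries σ k) :
    Ψ (MvPowerSeries.rename (Function.Embedding.inl : σ ↪ σ ⊕ τ) f) = algebraMap R S (Φ f) := by
  have := MvPowerSeries.algHom_ext_of_span_ne_top
    (Ψ.comp (MvPowerSeries.rename (Function.Embedding.inl : σ ↪ σ ⊕ τ)))
    ((IsScalarTower.toAlgHom k R S).comp Φ) (fun i => by simp [hX]) J hJ
    (fun i => by simpa [← hX] using hJX (Sum.inl i))
  exact DFunLike.congr_fun this f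

/-- The canonical map `Ω_R → Ω_S` has torsion kernel. -/
theorem mem_torsion_of_inlCoeffs_mem [IsDomain R] [IsFractionRing R Q] [Fintype σ]
    [Fintype τ] [IsNoetherianRing S] (hΦ : Function.Surjective Φ)
    (hX : ∀ i, Ψ (MvPowerSeries.X (Sum.inl i)) = algebraMap R S (Φ (MvPowerSeries.X i)))
    (J : Ideal S) (hJ : J ≠ ⊤) (hJX : ∀ i, Ψ (MvPowerSeries.X i) ∈ J)
    (hS : ∀ y : S, ∃ (r : R) (q : τ → k), y = algebraMap R S r +
      ∑ j, q j • Ψ (MvPowerSeries.X (Sum.inr j)))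
    (v : σ → R) (hv : UnivFinDiff.inlCoeffs σ τ R S v ∈ jacobianRelations Ψ) :
    UnivFinDiff.ofCoeffs Φ v ∈ Submodule.torsion R (UnivFinDiff Φ) := by
  classical
  obtain ⟨d, hd⟩ := exists_derivation_quotient_fracJacobianRelations (Q := Q) Φ hΦ
  obtain ⟨dQ, hdQ⟩ := d.exists_extend_fractionRing (Q := Q)
  let dS := dQ.compAlgebraMap (R := k) (A := S)
  have hdS (y : S) : dS y = dQ y := rfl
  have hcoe (y : S) (m : (σ → Q) ⧸ fracJacobianRelations Q Φ) : y • m = (y : Q) • m := rfl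
  have : Module.IsTorsionFree S ((σ → Q) ⧸ fracJacobianRelations Q Φ) := by
    refine ⟨fun y hy m m' h => ?_⟩
    have hy0 : (y : Q) ≠ 0 := fun h => hy.ne_zero (Subtype.ext h)
    exact smul_right_injective _ hy0 h
  have hsum (u : σ → R) : (fracJacobianRelations Q Φ).mkQ (fun i => algebraMap R Q (u i)) =
      ∑ i, algebraMap R Q (u i) • d (Φ (MvPowerSeries.X i)) := by
    simp only [hd, ← map_smul, ← map_sum]
    congr 1
    ext j
    simp [MvPowerSeries.pderiv_X, Pi.single_apply, apply_ite, Algebra.smul_def]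
  have hdX (i : σ) : dS (Ψ (MvPowerSeries.X (Sum.inl i))) = d (Φ (MvPowerSeries.X i)) := by
    rw [hX, hdS, ← hdQ]; rfl
  -- The finitely generated target demanded by the chain rule; it contains every `dS y` because `S =
  -- R + ∑ k T_j`.
  let L : Submodule S ((σ → Q) ⧸ fracJacobianRelations Q Φ) :=
    Submodule.span S (Set.range fun i => dS (Ψ (MvPowerSeries.X i)))
  have hL (i) : dS (Ψ (MvPowerSeries.X i)) ∈ L := Submodule.subset_span ⟨i, rfl⟩
  have hdL : ∀ y, dS y ∈ L := by
    intro y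
    obtain ⟨r, q, rfl⟩ := hS y
    obtain ⟨f, rfl⟩ := hΦ r
    rw [map_add, map_sum]
    refine add_mem ?_ (sum_mem fun j _ => ?_)
    · have : dS (algebraMap R S (Φ f)) = d (Φ f) := by rw [hdS, ← hdQ]; rfl
      rw [this, hd, hsum]
      refine sum_mem fun i _ => ?_
      rw [← hdX]
      exact L.smul_mem (algebraMap R S _) (hL _)
    · rw [Derivation.map_smul, ← algebraMap_smul S (q j)]
      exact L.smul_mem _ (hL _)
  have chain := dS.apply_algHom_mvPowerSeries Ψ J hJ hJX L
    (Submodule.fg_span (Set.finite_range _)) hdL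
  -- All linear relations among the `dS (Ψ X_i)`. By the chain rule they include the Jacobian
  -- relations of `Ψ`, so `v` gives a relation among the `dx_i` over `Q`.
  let P : Submodule S (σ ⊕ τ → S) :=
    LinearMap.ker (Fintype.linearCombination S fun i => dS (Ψ (MvPowerSeries.X i)))
  have hP : jacobianRelations Ψ ≤ P := by
    refine Submodule.span_le.mpr ?_
    rintro _ ⟨f, hf, rfl⟩
    rw [SetLike.mem_coe, LinearMap.mem_ker, Fintype.linearCombination_apply, ← chain, hf, map_zero]
  have hvP := hP hv
  rw [LinearMap.mem_ker, Fintype.linearCombination_apply, Fintype.sum_sum_type] at hvP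
  apply ofCoeffs_mem_torsion_of_mem_fracJacobianRelations (Q := Q)
  rw [← Submodule.Quotient.mk_eq_zero, ← Submodule.mkQ_apply, hsum]
  simpa [UnivFinDiff.inlCoeffs, hdX, hcoe] using hvP

/-- If `y ∈ S` kills the image of `ω` and `y = a / b` over `R`, then so does `a`; thus `a • ω` is in
the torsion kernel. -/
theorem mem_torsion_of_map_mem_torsion [IsDomain R] [IsFractionRing R Q] [Fintype σ]
    [Fintype τ] [IsNoetherianRing S] (hΦ : Function.Surjective Φ)
    (h : ∀ f, Ψ (MvPowerSeries.rename (Function.Embedding.inl : σ ↪ σ ⊕ τ) f) =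
      algebraMap R S (Φ f))
    (hX : ∀ i, Ψ (MvPowerSeries.X (Sum.inl i)) = algebraMap R S (Φ (MvPowerSeries.X i)))
    (J : Ideal S) (hJ : J ≠ ⊤) (hJX : ∀ i, Ψ (MvPowerSeries.X i) ∈ J)
    (hS : ∀ y : S, ∃ (r : R) (q : τ → k), y = algebraMap R S r +
      ∑ j, q j • Ψ (MvPowerSeries.X (Sum.inr j)))
    (ω : UnivFinDiff Φ)
    (hω : UnivFinDiff.map Φ Ψ h ω ∈ Submodule.torsion S (UnivFinDiff Ψ)) :
    ω ∈ Submodule.torsion R (UnivFinDiff Φ) := by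
  rw [Submodule.mem_torsion_iff] at hω
  obtain ⟨⟨y, hy⟩, hyω⟩ := hω
  change y • UnivFinDiff.map Φ Ψ h ω = 0 at hyω
  have hy0 : (y : Q) ≠ 0 := fun e => nonZeroDivisors.ne_zero hy (Subtype.ext e)
  obtain ⟨a, b, hb, hab⟩ := IsFractionRing.div_surjective (A := R) (y : Q)
  have hbQ : algebraMap R Q b ≠ 0 := by simpa using nonZeroDivisors.ne_zero hb
  have hyb : algebraMap R S a = algebraMap R S b * y := by
    ext
    change algebraMap R Q a = algebraMap R Q b * y
    rw [← hab]; field_simp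
  have ha : a ≠ 0 := by
    rintro rfl
    exact hy0 (by rw [← hab]; simp)
  obtain ⟨v, rfl⟩ : ∃ v, UnivFinDiff.ofCoeffs Φ v = ω := Submodule.mkQ_surjective _ ω
  have h0 : UnivFinDiff.map Φ Ψ h (UnivFinDiff.ofCoeffs Φ (a • v)) = 0 := by
    have : UnivFinDiff.ofCoeffs Φ (a • v) = a • UnivFinDiff.ofCoeffs Φ v := map_smul _ _ _
    rw [this, map_smul, ← algebraMap_smul S a, hyb, mul_smul, hyω, smul_zero]
  rw [UnivFinDiff.map_ofCoeffs] at h0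
  have := mem_torsion_of_inlCoeffs_mem Φ Ψ hΦ hX J hJ hJX hS (a • v)
    ((Submodule.Quotient.mk_eq_zero _).mp h0)
  rw [Submodule.mem_torsion_iff] at this ⊢
  obtain ⟨⟨e, he⟩, hev⟩ := this
  refine ⟨⟨e * a, mul_mem he (mem_nonZeroDivisors_of_ne_zero ha)⟩, ?_⟩
  change (e * a) • _ = (0 : UnivFinDiff Φ)
  rw [mul_smul]
  exact hev

end Extension

end

/-! ### Differentials modulo the image of `Ω_R` -/

noncomputable section

theorem apply_X_mem_maximalIdeal {k : Type*} [Field k] {R : Type*} [CommRing R] [IsLocalRing R]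
    [Algebra k R] {σ : Type*} (Φ : MvPowerSeries σ k →ₐ[k] R) (hΦ : Function.Surjective Φ)
    (i : σ) : Φ (MvPowerSeries.X i) ∈ IsLocalRing.maximalIdeal R := by
  rw [IsLocalRing.mem_maximalIdeal, mem_nonunits_iff]
  intro hu
  have : IsLocalHom Φ.toRingHom := IsLocalHom.of_surjective _ hΦ
  have := IsUnit.of_map Φ.toRingHom _ hu
  rw [MvPowerSeries.isUnit_iff_constantCoeff] at this
  simp at this

theorem exists_eq_algebraMap_add_sum {k : Type*} [Field k] {R : Type*} [CommRing R]
    [Algebra k R] {σ : Type*} [Fintype σ] (Φ : MvPowerSeries σ k →ₐ[k] R)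
    (hΦ : Function.Surjective Φ) (r : R) :
    ∃ (a : k) (g : σ → R), r = algebraMap k R a + ∑ i, Φ (MvPowerSeries.X i) * g i := by
  obtain ⟨f, rfl⟩ := hΦ r
  obtain ⟨h, hh⟩ := f.exists_eq_C_add_sum_X_mul
  have hC (a : k) : Φ (MvPowerSeries.C a) = algebraMap k R a := Φ.commutes a
  refine ⟨MvPowerSeries.constantCoeff f, fun i => Φ (h i), ?_⟩
  conv_lhs => rw [hh]
  simp [hC]

theorem exists_eq_sum_of_mem_maximalIdeal {k : Type*} [Field k] {R : Type*} [CommRing R]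
    [IsLocalRing R] [Algebra k R] {σ : Type*} [Fintype σ] (Φ : MvPowerSeries σ k →ₐ[k] R)
    (hΦ : Function.Surjective Φ) (r : R) (hr : r ∈ IsLocalRing.maximalIdeal R) :
    ∃ g : σ → R, r = ∑ i, Φ (MvPowerSeries.X i) * g i := by
  obtain ⟨a, g, rfl⟩ := exists_eq_algebraMap_add_sum Φ hΦ r
  refine ⟨g, ?_⟩
  suffices a = 0 by simp [this]
  by_contra ha
  have h1 : algebraMap k R a ∈ IsLocalRing.maximalIdeal R := by
    have := sub_mem hr (sum_mem (t := Finset.univ) fun i _ => Ideal.mul_mem_right (g i) _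
      (apply_X_mem_maximalIdeal Φ hΦ i))
    simpa using this
  exact (IsLocalRing.mem_maximalIdeal _).mp h1 ((IsUnit.mk0 a ha).map _)

section Span

variable {k : Type*} [Field k] {R : Type*} [CommRing R] [Algebra k R]
  {S : Type*} [CommRing S] [Algebra R S] [Algebra k S] [IsScalarTower k R S]
  {σ τ : Type*} (Φ : MvPowerSeries σ k →ₐ[k] R)
  (Ψ : MvPowerSeries (σ ⊕ τ) k →ₐ[k] S)

/-- If `S = R + ∑ k T_j` and all products `T_i T_j` lie in the maximal ideal of `R`, then the
`R`-part of a nonunit of `S` lies in the maximal ideal of `R`. -/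
theorem mem_maximalIdeal_of_not_isUnit [IsLocalRing R] [Fintype τ] (T : τ → S)
    (hTT : ∀ i j, ∃ r ∈ IsLocalRing.maximalIdeal R, algebraMap R S r = T i * T j)
    (r : R) (q : τ → k) (h : ¬ IsUnit (algebraMap R S r + ∑ j, q j • T j)) :
    r ∈ IsLocalRing.maximalIdeal R := by
  by_contra hr
  rw [IsLocalRing.mem_maximalIdeal, mem_nonunits_iff, not_not] at hr
  choose p hp hpT using hTT
  -- With `w = ∑ q_j T_j`, one has `w² ∈ m`. If `r` were a unit, `(r + w)(r - w) = r² - w²` would be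
  -- a unit of `R`, making `r + w` a unit of `S`.
  have hsq : (∑ j, q j • T j) * (∑ j, q j • T j) =
      algebraMap R S (∑ i, ∑ j, (q i * q j) • p i j) := by
    simp only [Finset.sum_mul_sum, map_sum, smul_mul_smul_comm, ← hpT]
    refine Finset.sum_congr rfl fun i _ => Finset.sum_congr rfl fun j _ => ?_
    exact (map_smul (IsScalarTower.toAlgHom k R S) _ _).symm
  have hm : ∑ i, ∑ j, (q i * q j) • p i j ∈ IsLocalRing.maximalIdeal R := by
    refine sum_mem fun i _ => sum_mem fun j _ => ?_
    rw [← algebraMap_smul R]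
    exact Submodule.smul_mem _ _ (hp i j)
  have hu : IsUnit (r * r - ∑ i, ∑ j, (q i * q j) • p i j) := by
    by_contra hnu
    have := add_mem ((IsLocalRing.mem_maximalIdeal _).mpr hnu) hm
    rw [sub_add_cancel] at this
    exact (IsLocalRing.mem_maximalIdeal _).mp this (hr.mul hr)
  have hu' := hu.map (algebraMap R S)
  rw [map_sub, map_mul, ← hsq, mul_self_sub_mul_self] at hu'
  exact h (isUnit_of_mul_isUnit_left hu')

/-- The differentials `T_j dx_i` and `T_i dT_j`, `i < j`. -/
def mixedDifferentials [DecidableEq σ] [LinearOrder τ] :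
    (σ × τ) ⊕ {p : τ × τ // p.1 < p.2} → UnivFinDiff Ψ :=
  Sum.elim (fun p => Ψ (MvPowerSeries.X (Sum.inr p.2)) • UnivFinDiff.dX Ψ (Sum.inl p.1))
    (fun p => Ψ (MvPowerSeries.X (Sum.inr p.1.1)) • UnivFinDiff.dX Ψ (Sum.inr p.1.2))

/-- Modulo the image of `Ω_R`, every differential whose `dT_j`-coefficients are nonunits is a
`k`-linear combination of the differentials `T_j dx_i` and `T_i dT_j`, `i < j`. -/
theorem ofCoeffs_mem_range_sup_span [CharZero k] [IsLocalRing R] [Fintype σ] [Fintype τ]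
    [DecidableEq σ] [LinearOrder τ] (hΦ : Function.Surjective Φ)
    (h : ∀ f, Ψ (MvPowerSeries.rename (Function.Embedding.inl : σ ↪ σ ⊕ τ) f) =
      algebraMap R S (Φ f))
    (hX : ∀ i, Ψ (MvPowerSeries.X (Sum.inl i)) = algebraMap R S (Φ (MvPowerSeries.X i)))
    (hS : ∀ y : S, ∃ (r : R) (q : τ → k), y = algebraMap R S r +
      ∑ j, q j • Ψ (MvPowerSeries.X (Sum.inr j)))
    (hXT : ∀ i j, ∃ r, algebraMap R S r =
      Ψ (MvPowerSeries.X (Sum.inl i)) * Ψ (MvPowerSeries.X (Sum.inr j)))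
    (hTT : ∀ i j, ∃ r ∈ IsLocalRing.maximalIdeal R, algebraMap R S r =
      Ψ (MvPowerSeries.X (Sum.inr i)) * Ψ (MvPowerSeries.X (Sum.inr j)))
    (r : σ ⊕ τ → S) (hr : ∀ j, ¬ IsUnit (r (Sum.inr j))) :
    UnivFinDiff.ofCoeffs Ψ r ∈ (LinearMap.range (UnivFinDiff.map Φ Ψ h)).restrictScalars k ⊔
      Submodule.span k (Set.range (mixedDifferentials Ψ)) := by
  set I := (LinearMap.range (UnivFinDiff.map Φ Ψ h)).restrictScalars k
  set P := I ⊔ Submodule.span k (Set.range (mixedDifferentials Ψ))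
  have hI : ∀ ω ∈ LinearMap.range (UnivFinDiff.map Φ Ψ h), ω ∈ P := fun ω hω =>
    (le_sup_left : I ≤ P) hω
  have hw : ∀ l, mixedDifferentials Ψ l ∈ P := fun l =>
    (le_sup_right : _ ≤ P) (Submodule.subset_span ⟨l, rfl⟩)
  have hdx : ∀ (y : S) (i : σ), y • UnivFinDiff.dX Ψ (Sum.inl i) ∈ P := by
    intro y i
    obtain ⟨r, q, rfl⟩ := hS y
    rw [add_smul, Finset.sum_smul]
    refine add_mem (hI _ ?_) (sum_mem fun j _ => ?_)
    · rw [algebraMap_smul, ← UnivFinDiff.map_dX Φ Ψ h]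
      exact Submodule.smul_mem _ _ ⟨_, rfl⟩
    · rw [smul_assoc]
      exact P.smul_mem _ (hw (Sum.inl (i, j)))
  have hTdT : ∀ i j, Ψ (MvPowerSeries.X (Sum.inr i)) • UnivFinDiff.dX Ψ (Sum.inr j) ∈ P := by
    intro i j
    have hprod : ∀ i j, Ψ (MvPowerSeries.X (Sum.inr i)) • UnivFinDiff.dX Ψ (Sum.inr j) +
        Ψ (MvPowerSeries.X (Sum.inr j)) • UnivFinDiff.dX Ψ (Sum.inr i) ∈ P := by
      intro i j
      obtain ⟨p, -, hp⟩ := hTT i j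
      rw [← UnivFinDiff.total_X_mul_X]
      exact hI _ (UnivFinDiff.total_mem_range_map Φ Ψ h hΦ _ p (by rw [map_mul, hp]))
    rcases lt_trichotomy i j with hij | rfl | hij
    · exact hw (Sum.inr ⟨(i, j), hij⟩)
    -- Here characteristic 0 enters: `T_i dT_i = d(T_i²) / 2`.
    · have := P.smul_mem (2⁻¹ : k) (hprod i i)
      rwa [← two_smul k, smul_smul, inv_mul_cancel₀ two_ne_zero, one_smul] at this
    · have := sub_mem (hprod i j) (hw (Sum.inr ⟨(j, i), hij⟩))
      simpa [mixedDifferentials] using this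
  have hmdT : ∀ p ∈ IsLocalRing.maximalIdeal R, ∀ j,
      algebraMap R S p • UnivFinDiff.dX Ψ (Sum.inr j) ∈ P := by
    intro p hp j
    obtain ⟨g, rfl⟩ := exists_eq_sum_of_mem_maximalIdeal Φ hΦ p hp
    rw [map_sum, Finset.sum_smul]
    refine sum_mem fun i _ => ?_
    -- Uses `x_i dT_j = d(x_i T_j) - T_j dx_i`, multiplied by `g i`.
    obtain ⟨x, hx⟩ := hXT i j
    have hmem := UnivFinDiff.total_mem_range_map Φ Ψ h hΦ
      (MvPowerSeries.X (Sum.inl i) * MvPowerSeries.X (Sum.inr j)) x (by rw [map_mul, hx])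
    have := sub_mem (hI _ (Submodule.smul_mem _ (g i) hmem))
      (hdx (algebraMap R S (g i) * Ψ (MvPowerSeries.X (Sum.inr j))) i)
    rwa [UnivFinDiff.total_X_mul_X, smul_add, ← algebraMap_smul S (g i),
      ← algebraMap_smul S (g i) (Ψ (MvPowerSeries.X (Sum.inr j)) • UnivFinDiff.dX Ψ (Sum.inl i)),
      mul_smul, add_sub_cancel_right, smul_smul, hX, ← map_mul, mul_comm] at this
  rw [UnivFinDiff.ofCoeffs_eq_sum, Fintype.sum_sum_type]
  refine add_mem (sum_mem fun i _ => hdx _ i) (sum_mem fun j _ => ?_)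
  obtain ⟨p, q, hpq⟩ := hS (r (Sum.inr j))
  have hp : p ∈ IsLocalRing.maximalIdeal R :=
    mem_maximalIdeal_of_not_isUnit _ hTT p q (hpq ▸ hr j)
  rw [hpq, add_smul, Finset.sum_smul]
  refine add_mem (hmdT p hp j) (sum_mem fun i _ => ?_)
  rw [smul_assoc]
  exact P.smul_mem _ (hTdT i j)

end Span

/-- The theorem freed of valuations: only `S = R + ∑ k T_j`, `x_i T_j ∈ R`, `T_i T_j ∈ m` and a
proper ideal containing all variables matter. -/
theorem exists_torsion_of_linearIndependent {k : Type*} [Field k] [CharZero k]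
    {R : Type*} [CommRing R] [IsDomain R] [IsLocalRing R] [IsNoetherianRing R] [Algebra k R]
    {n s : ℕ} {S : Subalgebra R (FractionRing R)}
    (Φ : MvPowerSeries (Fin n) k →ₐ[k] R) (hΦ : Function.Surjective Φ)
    (Ψ : MvPowerSeries (Fin n ⊕ Fin s) k →ₐ[k] S)
    (hX : ∀ i, Ψ (MvPowerSeries.X (Sum.inl i)) = algebraMap R S (Φ (MvPowerSeries.X i)))
    (J : Ideal S) (hJ : J ≠ ⊤) (hJX : ∀ i, Ψ (MvPowerSeries.X i) ∈ J)
    (hS : ∀ y : S, ∃ (r : R) (q : Fin s → k), y = algebraMap R S r +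
      ∑ j, q j • Ψ (MvPowerSeries.X (Sum.inr j)))
    (hXT : ∀ i j, ∃ r, algebraMap R S r =
      Ψ (MvPowerSeries.X (Sum.inl i)) * Ψ (MvPowerSeries.X (Sum.inr j)))
    (hTT : ∀ i j, ∃ r ∈ IsLocalRing.maximalIdeal R, algebraMap R S r =
      Ψ (MvPowerSeries.X (Sum.inr i)) * Ψ (MvPowerSeries.X (Sum.inr j)))
    (τ : Fin (n * s + s.choose 2 + 1) → UnivFinDiff Ψ) (hτ : LinearIndependent k τ)
    (hτtors : ∀ l, τ l ∈ Submodule.torsion S (UnivFinDiff Ψ))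
    (hτunit : ∀ l, ∃ r : Fin n ⊕ Fin s → S,
      τ l = UnivFinDiff.ofCoeffs Ψ r ∧ ∀ j, ¬ IsUnit (r (Sum.inr j))) :
    ∃ F : UnivFinDiff Φ →ₗ[R] UnivFinDiff Ψ,
      (∀ i, F (UnivFinDiff.dX Φ i) = UnivFinDiff.dX Ψ (Sum.inl i)) ∧
      ∃ (q : Fin (n * s + s.choose 2 + 1) → k) (ω : UnivFinDiff Φ),
        q ≠ 0 ∧ ω ∈ Submodule.torsion R (UnivFinDiff Φ) ∧ ω ≠ 0 ∧ F ω = ∑ l, q l • τ l := by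
  have := finite_of_exists_eq_add_sum Ψ hS
  have : IsNoetherianRing S := IsNoetherianRing.of_finite R S
  have h := apply_rename_inl Φ Ψ hX J hJ hJX
  refine ⟨UnivFinDiff.map Φ Ψ h, UnivFinDiff.map_dX Φ Ψ h, ?_⟩
  obtain ⟨q, hq, ω, hω⟩ := exists_ne_zero_sum_mem_of_card_lt
    ((LinearMap.range (UnivFinDiff.map Φ Ψ h)).restrictScalars k) (mixedDifferentials Ψ) τ
    (fun l => by
      obtain ⟨r, hr, hru⟩ := hτunit l
      rw [hr]
      exact ofCoeffs_mem_range_sup_span Φ Ψ hΦ h hX hS hXT hTT r hru)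
    (by
      rw [Fintype.card_sum, Fintype.card_prod, Fintype.card_subtype,
        Fintype.card_product_filter_lt]
      simp)
  refine ⟨q, ω, hq, ?_, ?_, hω⟩
  · refine mem_torsion_of_map_mem_torsion Φ Ψ hΦ h hX J hJ hJX hS ω ?_
    rw [hω]
    refine sum_mem fun l _ => ?_
    rw [← algebraMap_smul S (q l)]
    exact Submodule.smul_mem _ _ (hτtors l)
  · rintro rfl
    rw [map_zero] at hω
    exact hq (funext (Fintype.linearIndependent_iff.mp hτ q hω.symm))

end

/-! ### Orders, the conductor and the residue field of `R̄` -/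

noncomputable section

section Uniformizer

variable {A : Type*} [CommRing A] {t : A}

theorem IsUniformizingParameter.not_dvd_unit (ht : IsUniformizingParameter t) (u : Aˣ) :
    ¬ t ∣ (u : A) := fun h => (ht.2 u).mp h u.isUnit

/-- Factors `t` are divided out until the quotient is a unit or `m` of them have been removed. -/
theorem IsUniformizingParameter.pow_dvd_or_hasOrd (ht : IsUniformizingParameter t) (y : A)
    (m : ℕ) : t ^ m ∣ y ∨ ∃ v < m, HasOrd t y v := by
  induction m with
  | zero => simp
  | succ m ih =>
    rcases ih with ⟨z, hz⟩ | ⟨v, hv, h⟩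
    · by_cases hu : IsUnit z
      · exact Or.inr ⟨m, m.lt_succ_self, hu.unit, by rw [hz, IsUnit.unit_spec, mul_comm]⟩
      · obtain ⟨w, rfl⟩ := (ht.2 z).mpr hu
        exact Or.inl ⟨w, by rw [hz, pow_succ, mul_assoc]⟩
    · exact Or.inr ⟨v, hv.trans m.lt_succ_self, h⟩

theorem IsUniformizingParameter.le_of_pow_dvd [IsDomain A] (ht : IsUniformizingParameter t)
    {u : Aˣ} {v m : ℕ} (h : t ^ m ∣ u * t ^ v) : m ≤ v := by
  by_contra! hlt
  obtain ⟨z, hz⟩ := h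
  obtain ⟨d, rfl⟩ := Nat.exists_eq_add_of_lt hlt
  refine ht.not_dvd_unit u ⟨t ^ d * z, mul_right_cancel₀ (pow_ne_zero v ht.1) ?_⟩
  rw [hz]
  ring

end Uniformizer

section Conductor

variable {R : Type*} [CommRing R] [IsDomain R]

theorem mul_mem_fracConductor {y : FractionRing R} (hy : y ∈ fracConductor R)
    (z : normalization R) : y * z ∈ fracConductor R := by
  rw [fracConductor, Submodule.mem_div_iff_forall_mul_mem] at hy ⊢
  intro w hw
  rw [mul_assoc]
  exact hy _ ((normalization R).mul_mem z.2 hw)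

theorem exists_mem_conductorIdeal {y : FractionRing R} (hy : y ∈ fracConductor R) :
    ∃ r ∈ conductorIdeal R, algebraMap R (FractionRing R) r = y := by
  have h := (Submodule.mem_div_iff_forall_mul_mem.mp hy) 1 (one_mem (normalization R))
  rw [mul_one, Submodule.mem_one] at h
  obtain ⟨r, rfl⟩ := h
  exact ⟨r, hy, rfl⟩

/-- The conductor is stable under `R̄`, so an element `u t ^ c` in it yields all multiples of `t ^
c`. With `exists_pow_dvd` this gives `C_R = t ^ c R̄`. -/
theorem IsConductorExponent.mem_fracConductor {t : normalization R} {c : ℕ}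
    (hc : IsConductorExponent R t c) {z : normalization R} (hz : t ^ c ∣ z) :
    (z : FractionRing R) ∈ fracConductor R := by
  obtain ⟨w, rfl⟩ := hz
  obtain ⟨⟨r, hr, u, hu⟩, -⟩ := hc
  have := mul_mem_fracConductor (y := algebraMap R (FractionRing R) r) hr (↑u⁻¹ * w)
  have e : ((algebraMap R (normalization R) r * (↑u⁻¹ * w) : normalization R) : FractionRing R) =
      algebraMap R (FractionRing R) r * ((↑u⁻¹ * w : normalization R) : FractionRing R) := rfl
  rw [← e, hu] at this
  convert! this using 2
  rw [mul_comm (u : normalization R), mul_assoc, Units.mul_inv_cancel_left]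

theorem IsConductorExponent.exists_pow_dvd {t : normalization R} {c : ℕ}
    (ht : IsUniformizingParameter t) (hc : IsConductorExponent R t c) {y : FractionRing R}
    (hy : y ∈ fracConductor R) : ∃ z : normalization R, (z : FractionRing R) = y ∧ t ^ c ∣ z := by
  obtain ⟨r, hr, rfl⟩ := exists_mem_conductorIdeal hy
  refine ⟨algebraMap R _ r, rfl, ?_⟩
  rcases ht.pow_dvd_or_hasOrd (algebraMap R _ r) c with h | ⟨v, hv, h⟩
  · exact h
  · exact absurd (hc.2 ⟨r, hr, h⟩) (not_le.mpr hv)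

theorem dvd_algebraMap_of_mem_maximalIdeal [IsLocalRing R] {t : normalization R}
    (ht : IsUniformizingParameter t) {r : R} (hr : r ∈ IsLocalRing.maximalIdeal R) :
    t ∣ algebraMap R (normalization R) r := by
  rw [ht.2]
  intro hu
  have : IsLocalHom (algebraMap R (normalization R)) := inferInstance
  exact (IsLocalRing.mem_maximalIdeal _).mp hr (IsUnit.of_map _ _ hu)

/-- The residue field of the normalization is `k`. -/
theorem exists_dvd_sub_algebraMap {k : Type*} [Field k] [IsAlgClosed k] [IsLocalRing R]
    [Algebra k R] (hk : ∀ r : R, ∃ a : k, r - algebraMap k R a ∈ IsLocalRing.maximalIdeal R)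
    {t : normalization R} (ht : IsUniformizingParameter t) (z : normalization R) :
    ∃ a : k, t ∣ z - algebraMap k (normalization R) a := by
  let L := normalization R ⧸ Ideal.span {t}
  have hmem (y : normalization R) : y ∈ Ideal.span {t} ↔ ¬ IsUnit y := by
    rw [Ideal.mem_span_singleton, ht.2]
  have : Nontrivial L := Ideal.Quotient.nontrivial_iff.mpr fun h => by
    have := (hmem 1).mp (h ▸ Submodule.mem_top)
    exact this isUnit_one
  have hmax : (Ideal.span {t} : Ideal (normalization R)).IsMaximal := by
    refine Ideal.isMaximal_iff.mpr ⟨fun h => (hmem 1).mp h isUnit_one, fun I y _ hy hyI => ?_⟩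
    rw [hmem, not_not] at hy
    exact Ideal.eq_top_iff_one I |>.mp (Ideal.eq_top_of_isUnit_mem I hyI hy)
  let φ : R →+* L := (Ideal.Quotient.mk _).comp (algebraMap R (normalization R))
  let ψ : k →+* L := φ.comp (algebraMap k R)
  have hφ : φ.IsIntegral := RingHom.IsIntegral.trans _ _ 
    (fun y => Algebra.IsIntegral.isIntegral y)
    (RingHom.isIntegral_of_surjective _ Ideal.Quotient.mk_surjective)
  have hrange (r : R) : ∃ a, ψ a = φ r := by
    obtain ⟨a, ha⟩ := hk r
    refine ⟨a, ?_⟩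
    rw [eq_comm, ← sub_eq_zero]
    change φ r - φ _ = 0
    rw [← map_sub]
    exact Ideal.Quotient.eq_zero_iff_mem.mpr (Ideal.mem_span_singleton.mpr
      (dvd_algebraMap_of_mem_maximalIdeal ht ha))
  -- `R` and `k` have the same image in `R̄ / (t)`, so monic equations over `R` lift to monic ones
  -- over `k`; as `k` is algebraically closed, `ψ` is onto.
  have hψ : ψ.IsIntegral := by
    intro y
    obtain ⟨p, hp, hpy⟩ := hφ y
    have hl : p.map φ ∈ Polynomial.lifts ψ := by
      rw [Polynomial.lifts_iff_coeff_lifts]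
      intro m
      rw [Polynomial.coeff_map]
      exact hrange _
    obtain ⟨q, hq, -, hqm⟩ := Polynomial.lifts_and_natDegree_eq_and_monic hl (hp.map φ)
    refine ⟨q, hqm, ?_⟩
    rw [Polynomial.eval₂_eq_eval_map, hq, ← Polynomial.eval₂_eq_eval_map, hpy]
  let : Field L := Ideal.Quotient.field _
  obtain ⟨a, ha⟩ := (IsAlgClosed.ringHom_bijective_of_isIntegral ψ hψ).2 (Ideal.Quotient.mk _ z)
  refine ⟨a, Ideal.mem_span_singleton.mp (Ideal.Quotient.eq.mp ?_)⟩
  rw [← ha]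
  rfl

/-- If every order between `e` and `c` is attained by an element of a `k`-subspace `G` of the
normalization that contains `t ^ c R̄`, then `G` contains `t ^ e R̄`. -/
theorem mem_of_pow_dvd {k A : Type*} [Field k] [CommRing A] [Algebra k A] {t : A}
    (hres : ∀ z : A, ∃ a : k, t ∣ z - algebraMap k A a) (G : Submodule k A) {e c : ℕ}
    (hG : ∀ z, t ^ c ∣ z → z ∈ G) (hord : ∀ w, e ≤ w → w < c → ∃ g ∈ G, HasOrd t g w)
    {z : A} (hz : t ^ e ∣ z) : z ∈ G := by
  have key : ∀ (d w : ℕ), e ≤ w → c ≤ w + d → ∀ z, t ^ w ∣ z → z ∈ G := by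
    intro d
    induction d with
    | zero => exact fun w _ hcw z hz => hG z ((pow_dvd_pow t hcw).trans hz)
    | succ d ih =>
      intro w hew hcw z hz
      rcases le_or_gt c w with h | h
      · exact hG z ((pow_dvd_pow t h).trans hz)
      obtain ⟨g, hg, u, rfl⟩ := hord w hew h
      obtain ⟨y, rfl⟩ := hz
      -- `a` is the ratio of the leading coefficients of `z` and `g`, so `z - a • g` is divisible by
      -- `t ^ (w + 1)`.
      obtain ⟨a, y', hy'⟩ := hres (y * ↑u⁻¹)
      have hmem := ih (w + 1) (by omega) (by omega) (t ^ w * y - a • (u * t ^ w)) ⟨y' * u, by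
        rw [Algebra.smul_def, pow_succ]
        have : y = (y * ↑u⁻¹) * u := by rw [mul_assoc, Units.inv_mul, mul_one]
        rw [this]
        linear_combination (t ^ w * u) * hy'⟩
      simpa using add_mem hmem (G.smul_mem a hg)
  exact key c e le_rfl (by omega) z hz

end Conductor

end

/-! ### The ring `R[C_R / x]` -/

noncomputable section

/-- Every element of `R[C_R / x]`, `x = t ^ e`, is the sum of an element of `R` and a multiple of
`t ^ (c - e)`. -/
theorem exists_eq_add_of_mem_conductorTransform {R : Type*} [CommRing R] [IsDomain R]
    {t : normalization R} (ht : IsUniformizingParameter t) {c e : ℕ}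
    (hc : IsConductorExponent R t c) (hec : e ≤ c) {x : R}
    (hx : algebraMap R (normalization R) x = t ^ e) {y : FractionRing R}
    (hy : y ∈ conductorTransform R x) :
    ∃ (r : R) (z : normalization R), t ^ (c - e) ∣ z ∧
      y = algebraMap R (FractionRing R) r + z := by
  induction hy using Algebra.adjoin_induction with
  | mem y hy =>
    obtain ⟨w, hw, rfl⟩ := hy
    obtain ⟨_, rfl, z, rfl⟩ := hc.exists_pow_dvd ht hw
    refine ⟨0, t ^ (c - e) * z, dvd_mul_right _ _, ?_⟩
    have hxQ : algebraMap R (FractionRing R) x = (t : FractionRing R) ^ e :=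
      congrArg Subtype.val hx
    have ht0 : (t : FractionRing R) ≠ 0 := fun h => ht.1 (Subtype.ext h)
    rw [hxQ, div_eq_iff (pow_ne_zero _ ht0)]
    push_cast
    rw [zero_add, mul_right_comm, ← pow_add, Nat.sub_add_cancel hec]
  | algebraMap r => exact ⟨r, 0, dvd_zero _, by simp⟩
  | add y y' _ _ h h' =>
    obtain ⟨r, z, hz, rfl⟩ := h
    obtain ⟨r', z', hz', rfl⟩ := h'
    exact ⟨r + r', z + z', dvd_add hz hz', by rw [map_add, Subalgebra.coe_add]; ring⟩
  | mul y y' _ _ h h' =>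
    obtain ⟨r, z, hz, rfl⟩ := h
    obtain ⟨r', z', hz', rfl⟩ := h'
    refine ⟨r * r', algebraMap R _ r * z' + algebraMap R _ r' * z + z * z',
      dvd_add (dvd_add (hz'.mul_left _) (hz.mul_left _)) (hz.mul_right _), ?_⟩
    rw [map_mul, Subalgebra.coe_add, Subalgebra.coe_add, Subalgebra.coe_mul, Subalgebra.coe_mul,
      Subalgebra.coe_mul, Subalgebra.coe_algebraMap, Subalgebra.coe_algebraMap]
    ring

theorem conductorTransform_le_normalization {R : Type*} [CommRing R] [IsDomain R]
    {t : normalization R} (ht : IsUniformizingParameter t) {c e : ℕ}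
    (hc : IsConductorExponent R t c) (hec : e ≤ c) {x : R}
    (hx : algebraMap R (normalization R) x = t ^ e) :
    conductorTransform R x ≤ normalization R := by
  intro y hy
  obtain ⟨r, z, -, rfl⟩ := exists_eq_add_of_mem_conductorTransform ht hc hec hx hy
  exact add_mem ((normalization R).algebraMap_mem r) z.2

end

/-! ### The theorem, by checking orders -/

theorem mainTheorem5
    {k : Type*} [Field k] [IsAlgClosed k] [CharZero k]
    -- `R` is a one-dimensional complete local domain over `k` of embedding dimension `n`,
    {R : Type*} [CommRing R] [IsDomain R] [IsLocalRing R] [IsNoetherianRing R]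
    [IsAdicComplete (IsLocalRing.maximalIdeal R) R] [Algebra k R]
    (hdim : ringKrullDim R = 1)
    {n : ℕ} [NeZero n] (hedim : (IsLocalRing.maximalIdeal R).spanFinrank = n)
    -- presented by `Φ : k⟦X_1, …, X_n⟧ ↠ R`, `x_i = Φ X_i`.
    (Φ : MvPowerSeries (Fin n) k →ₐ[k] R) (hΦ : Function.Surjective Φ)
    -- In the integral closure, `x_i = α_i t ^ a_i` with `a_1 ≤ ⋯ ≤ a_n` and `α_1 = 1`.
    (t : normalization R) (ht : IsUniformizingParameter t)
    (a : Fin n → ℕ) (ha : Monotone a) (α : Fin n → (normalization R)ˣ) (hα : α 0 = 1)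
    (hx : ∀ i, algebraMap R (normalization R) (Φ (MvPowerSeries.X i)) = α i * t ^ a i)
    -- The conductor lies in the square of the maximal ideal; `c` is its valuation.
    (hC : conductorIdeal R ≤ IsLocalRing.maximalIdeal R ^ 2)
    (c : ℕ) (hc : IsConductorExponent R t c)
    -- `b_1 < ⋯ < b_s` are the integers in `[c - a_1, c - 1]` outside the valuation semigroup.
    {s : ℕ} (b : Fin s → ℕ) (hb : StrictMono b)
    (hbrange : Set.range b = {v | c ≤ v + a 0 ∧ v < c ∧ v ∉ valuationSemigroup R t})
    -- `S = R[C_R / x_1]`, presented by `X_i ↦ x_i`, `T_j ↦ t ^ b_j`.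
    (Ψ : MvPowerSeries (Fin n ⊕ Fin s) k →ₐ[k]
      conductorTransform R (Φ (MvPowerSeries.X 0)))
    (hΨX : ∀ i, (Ψ (MvPowerSeries.X (Sum.inl i)) : FractionRing R) =
      algebraMap R (FractionRing R) (Φ (MvPowerSeries.X i)))
    (hΨT : ∀ j, (Ψ (MvPowerSeries.X (Sum.inr j)) : FractionRing R) =
      (t : FractionRing R) ^ b j)
    -- `k`-linearly independent torsion elements of `Ω_S` with non-unit `dT_j`-coefficients.
    (τ : Fin (n * s + s.choose 2 + 1) → UnivFinDiff Ψ)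
    (hτ : LinearIndependent k τ)
    (hτtors : ∀ l, τ l ∈ Submodule.torsion
      (conductorTransform R (Φ (MvPowerSeries.X 0))) (UnivFinDiff Ψ))
    (hτunit : ∀ l, ∃ r : Fin n ⊕ Fin s → conductorTransform R (Φ (MvPowerSeries.X 0)),
      τ l = UnivFinDiff.ofCoeffs Ψ r ∧ ∀ j, ¬ IsUnit (r (Sum.inr j))) :
    -- `F : Ω_R → Ω_S` is the canonical map, `dx_i ↦ dx_i`.
    (∃ F : UnivFinDiff Φ →ₗ[R] UnivFinDiff Ψ,
      (∀ i, F (UnivFinDiff.dX Φ i) = UnivFinDiff.dX Ψ (Sum.inl i)) ∧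
      ∃ (q : Fin (n * s + s.choose 2 + 1) → k) (ω : UnivFinDiff Φ),
        q ≠ 0 ∧ ω ∈ Submodule.torsion R (UnivFinDiff Φ) ∧ ω ≠ 0 ∧ F ω = ∑ l, q l • τ l) ∧
    Submodule.torsion R (UnivFinDiff Φ) ≠ ⊥ := by
  have hx0 : algebraMap R (normalization R) (Φ (MvPowerSeries.X 0)) = t ^ a 0 := by
    rw [hx, hα, Units.val_one, one_mul]
  have ha0 : 1 ≤ a 0 := by
    have := dvd_algebraMap_of_mem_maximalIdeal ht (apply_X_mem_maximalIdeal Φ hΦ 0)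
    rw [hx, ← pow_one t, ← pow_mul, one_mul] at this
    exact ht.le_of_pow_dvd this
  have ha0le : ∀ i, a 0 ≤ a i := fun i => ha (Fin.zero_le _)
  have hm : ∀ r ∈ IsLocalRing.maximalIdeal R, t ^ a 0 ∣ algebraMap R (normalization R) r := by
    intro r hr
    obtain ⟨g, rfl⟩ := exists_eq_sum_of_mem_maximalIdeal Φ hΦ r hr
    rw [map_sum]
    refine Finset.dvd_sum fun i _ => ?_
    rw [map_mul, hx]
    exact ((pow_dvd_pow t (ha0le i)).mul_left _).mul_right _
  have hm2 : ∀ r ∈ IsLocalRing.maximalIdeal R ^ 2,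
      t ^ (2 * a 0) ∣ algebraMap R (normalization R) r := by
    intro r hr
    rw [pow_two] at hr
    induction hr using Submodule.mul_induction_on' with
    | mem_mul_mem p hp q hq =>
      rw [map_mul, two_mul, pow_add]
      exact mul_dvd_mul (hm p hp) (hm q hq)
    | add p _ q _ hp hq => rw [map_add]; exact dvd_add hp hq
  -- The consequence of `C_R ⊆ m²` that makes `b_i + b_j ≥ 2 (c - a₁) ≥ c`.
  have hca : 2 * a 0 ≤ c := by
    obtain ⟨⟨r, hr, u, hu⟩, -⟩ := hc
    exact ht.le_of_pow_dvd (hu ▸ hm2 r (hC hr))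
  have hCm : ∀ z : normalization R, t ^ c ∣ z → ∃ r ∈ IsLocalRing.maximalIdeal R,
      algebraMap R (FractionRing R) r = z := by
    intro z hz
    obtain ⟨r, hr, h⟩ := exists_mem_conductorIdeal (hc.mem_fracConductor hz)
    exact ⟨r, Ideal.pow_le_self two_ne_zero (hC hr), h⟩
  have hbj : ∀ j, c ≤ b j + a 0 := fun j => by
    have : b j ∈ Set.range b := ⟨j, rfl⟩
    rw [hbrange] at this
    exact this.1
  have hres := exists_dvd_sub_algebraMap (k := k) (R := R) (t := t) (fun r => by
    obtain ⟨l, g, rfl⟩ := exists_eq_algebraMap_add_sum Φ hΦ r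
    refine ⟨l, ?_⟩
    rw [add_sub_cancel_left]
    exact sum_mem fun i _ => Ideal.mul_mem_right _ _ (apply_X_mem_maximalIdeal Φ hΦ i)) ht
  -- `R + ∑ k t ^ b_j` attains every order in `[c - a₁, c - 1]`, by an element of `R` or by some `t
  -- ^ b_j`, so it contains `t ^ (c - a₁) R̄`.
  let G : Submodule k (normalization R) :=
    LinearMap.range (IsScalarTower.toAlgHom k R (normalization R)).toLinearMap ⊔
      Submodule.span k (Set.range fun j => t ^ b j)
  have hRG : ∀ r, algebraMap R (normalization R) r ∈ G := fun r =>
    (le_sup_left : _ ≤ G) ⟨r, rfl⟩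
  have hG : ∀ z : normalization R, t ^ (c - a 0) ∣ z → z ∈ G := fun z hz => by
    refine mem_of_pow_dvd hres G (c := c) (fun z hz => ?_) (fun w hw hwc => ?_) hz
    · obtain ⟨r, -, hr⟩ := hCm z hz
      have : algebraMap R (normalization R) r = z := Subtype.ext hr
      exact this ▸ hRG r
    · by_cases hws : w ∈ valuationSemigroup R t
      · obtain ⟨r, hr⟩ := hws
        exact ⟨_, hRG r, hr⟩
      · have : w ∈ Set.range b := by
          rw [hbrange]
          exact ⟨by omega, hwc, hws⟩
        obtain ⟨j, rfl⟩ := this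
        exact ⟨t ^ b j, (le_sup_right : _ ≤ G) (Submodule.subset_span ⟨j, rfl⟩), 1, by simp⟩
  let ι := Subalgebra.inclusion
    (conductorTransform_le_normalization ht hc (by omega : a 0 ≤ c) hx0)
  have hX : ∀ i, Ψ (MvPowerSeries.X (Sum.inl i)) =
      algebraMap R (conductorTransform R (Φ (MvPowerSeries.X 0))) (Φ (MvPowerSeries.X i)) :=
    fun i => Subtype.ext (hΨX i)
  have hιX : ∀ i, ι (Ψ (MvPowerSeries.X (Sum.inl i))) = α i * t ^ a i := fun i => by
    rw [hX, ← hx]; rfl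
  have hιT : ∀ j, ι (Ψ (MvPowerSeries.X (Sum.inr j))) = t ^ b j := fun j =>
    Subtype.ext (hΨT j)
  have hprod : ∀ y : conductorTransform R (Φ (MvPowerSeries.X 0)), t ^ c ∣ ι y →
      ∃ r ∈ IsLocalRing.maximalIdeal R, algebraMap R _ r = y := fun y hy => by
    obtain ⟨r, hr, h⟩ := hCm _ hy
    exact ⟨r, hr, Subtype.ext h⟩
  have main := exists_torsion_of_linearIndependent Φ hΦ Ψ hX
    ((Ideal.span {t}).comap ι.toRingHom) (by
      rw [Ne, Ideal.eq_top_iff_one, Ideal.mem_comap, map_one, Ideal.mem_span_singleton]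
      exact ht.not_dvd_unit 1)
    (by
      rintro (i | j)
      · refine Ideal.mem_span_singleton.mpr ?_
        change t ∣ ι _
        rw [hιX]
        -- The ideal `J` is the contraction of `(t)`, and `a i ≥ a 0 ≥ 1`; for the `T_j`, `b j ≥ c -
        -- a 0 ≥ a 0 ≥ 1`.
        exact (dvd_pow_self t (by have := ha0le i; omega)).mul_left _
      · refine Ideal.mem_span_singleton.mpr ?_
        change t ∣ ι _
        rw [hιT]
        exact dvd_pow_self t (by have := hbj j; omega))
    (by
      intro y
      obtain ⟨r, z, hz, hy⟩ := exists_eq_add_of_mem_conductorTransform ht hc (by omega) hx0 y.2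
      obtain ⟨_, ⟨r', rfl⟩, w, hw, hrw⟩ := Submodule.mem_sup.mp (hG z hz)
      obtain ⟨q, rfl⟩ := (Submodule.mem_span_range_iff_exists_fun k).mp hw
      refine ⟨r + r', q, ?_⟩
      apply Subalgebra.inclusion_injective
        (conductorTransform_le_normalization ht hc (by omega : a 0 ≤ c) hx0)
      change ι _ = ι _
      have hιy : ι y = algebraMap R (normalization R) r + z := Subtype.ext hy
      have hιk : ∀ (l : k) y, ι (l • y) = l • ι y := fun l y => Subtype.ext rfl
      rw [hιy, ← hrw, map_add, map_sum, AlgHom.commutes, map_add, add_assoc]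
      simp only [hιk, hιT]
      rfl)
    (by
      intro i j
      obtain ⟨r, -, hr⟩ := hprod (Ψ (MvPowerSeries.X (Sum.inl i)) * Ψ (MvPowerSeries.X (Sum.inr j)))
        (by
          rw [map_mul, hιX, hιT, mul_assoc, ← pow_add]
          exact (pow_dvd_pow t (by have := ha0le i; have := hbj j; omega)).mul_left _)
      exact ⟨r, hr⟩)
    (by
      intro i j
      refine hprod _ ?_
      rw [map_mul, hιT, hιT, ← pow_add]
      exact pow_dvd_pow t (by have := hbj i; have := hbj j; omega))
    τ hτ hτtors hτunit
  refine ⟨main, fun hbot => ?_⟩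
  obtain ⟨_, -, _, ω, -, hω, hω0, -⟩ := main
  rw [hbot, Submodule.mem_bot] at hω
  exact hω0 hω
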